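/- Let $(\alpha,\beta)\in\{(4,8),(8,4)\}$. Two points of $\mathbb{Z}^2$ are $4$-adjacent if their $\ell_1$ distance is $1$, and $8$-adjacent if their $\ell_\infty$ distance is $1$. Let $T\subset\mathbb{Z}^2$ be a finite $\alpha$-connected component of a binary image, where a binary image is a map from a subset of $\mathbb{Z}^2$ to $\{\text{black},\text{white}\}$ and an $\alpha$-connected component is a maximal nonempty set of pixels of one color that are pairwise joined by $\alpha$-adjacent sequences of pixels of that color. Let $P_\alpha(T)$ be the set of points of $\mathbb{Z}^2\setminus T$ that are $\alpha$-adjacent to a point of $T$, and let $G_\alpha(T)$ be the graph on $\mathbb{Z}^2$ in which two points of $P_\alpha(T)$ are joined if they are $\beta$-adjacent, two points of $\mathbb{Z}^2\setminus P_\alpha(T)$ are joined if they are $\alpha$-adjacent, and there are no other edges. Then $G_\alpha(T)$ has exactly one infinite connected component $E_\alpha(T)$, it is contained in $\mathbb{Z}^2\setminus P_\alpha(T)$, and the exterior site perimeter $$P_\alpha^{ext}(T):=\{z\in P_\alpha(T) : z \text{ is } \alpha\text{-adjacent to a point of } E_\alpha(T)\}$$ is a simple $\beta$-connected cycle; that is,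 the graph induced on $P_\alpha^{ext}(T)$ by $\beta$-adjacency is a (chordless) cycle, and its length is at least $4$ if $\beta=8$ and at least $8$ if $\beta=4$. -/

import Mathlib

/-- Pixels are the points of `ℤ²`. -/
abbrev Pixel : Type := ℤ × ℤ

/-- The parameter `α ∈ {4, 8}`. -/
inductive Conn : Type
  | four
  | eight

/-- The dual parameter `β`: `(α, β) = (4, 8)` or `(8, 4)`. -/
def Conn.dual : Conn → Conn
  | .four => .eight
  | .eight => .four

/-- The metrics `d₄` (the `ℓ¹` metric) and `d₈` (the `ℓ^∞` metric) on `ℤ²`. -/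
def Conn.dist : Conn → Pixel → Pixel → ℤ
  | .four, x, y => |x.1 - y.1| + |x.2 - y.2|
  | .eight, x, y => max |x.1 - y.1| |x.2 - y.2|

theorem Conn.dist_comm (α : Conn) (x y : Pixel) : α.dist x y = α.dist y x := by
  cases α <;> simp [Conn.dist, abs_sub_comm]

theorem Conn.dist_self (α : Conn) (x : Pixel) : α.dist x x = 0 := by
  cases α <;> simp [Conn.dist]

/-- The graph of `d_α`-adjacency on `ℤ²`. -/
def adjGraph (α : Conn) : SimpleGraph Pixel where
  Adj x y := α.dist x y = 1
  symm := ⟨fun x y h => by rw [α.dist_comm]; exact h⟩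
  loopless := ⟨fun x h => by rw [α.dist_self] at h; exact zero_ne_one h⟩

inductive Color : Type
  | black
  | white

/-- A binary image: a map from a subset of `ℤ²` to `{black, white}`; the value `none` marks the
pixels outside the domain of the image. -/
abbrev BinaryImage : Type := Pixel → Option Color

/-- The `α`-adjacency of pixels (in the domain of `I`) that have the same color. -/
def monochromaticGraph (α : Conn) (I : BinaryImage) : SimpleGraph Pixel where
  Adj x y := (adjGraph α).Adj x y ∧ ∃ c : Color, I x = some c ∧ I y = some c
  symm := ⟨fun _ _ h => ⟨h.1.symm, h.2.elim fun c hc => ⟨c, hc.2, hc.1⟩⟩⟩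
  loopless := ⟨fun _ h => h.1.ne rfl⟩

/-- `T` is an `α`-connected component of the image `I`: a maximal set of pixels of one color
that are joined to each other by `α`-adjacent sequences of pixels of that color. -/
def IsConnComponent (α : Conn) (I : BinaryImage) (T : Set Pixel) : Prop :=
  ∃ x : Pixel, (I x).isSome ∧ T = {y | (monochromaticGraph α I).Reachable x y}

/-- The graph `I_α` of an image: white pixels are joined when they are `α`-adjacent, black pixels
when they are `β`-adjacent. Pixels outside the domain of `I` are isolated. -/
def imageGraph (α : Conn) (I : BinaryImage) : SimpleGraph Pixel where
  Adj x y :=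
    (I x = some .white ∧ I y = some .white ∧ (adjGraph α).Adj x y) ∨
    (I x = some .black ∧ I y = some .black ∧ (adjGraph α.dual).Adj x y)
  symm := ⟨fun _ _ h => h.imp (fun h => ⟨h.2.1, h.1, h.2.2.symm⟩)
    (fun h => ⟨h.2.1, h.1, h.2.2.symm⟩)⟩
  loopless := ⟨fun _ h => h.elim (fun h => h.2.2.ne rfl) (fun h => h.2.2.ne rfl)⟩

/-- The site perimeter `P_α(T)`. -/
def sitePerimeter (α : Conn) (T : Set Pixel) : Set Pixel :=
  {z | z ∉ T ∧ ∃ t ∈ T, (adjGraph α).Adj z t}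

open Classical in
/-- The image on all of `ℤ²` whose set of black pixels is `P_α(T)`. -/
noncomputable def perimeterImage (α : Conn) (T : Set Pixel) : BinaryImage :=
  fun z => if z ∈ sitePerimeter α T then some .black else some .white

/-- The characteristic graph `G_α(T)` of the site perimeter. -/
noncomputable def charGraph (α : Conn) (T : Set Pixel) : SimpleGraph Pixel :=
  imageGraph α (perimeterImage α T)

/-- `E_α(T)`: the white pixels whose connected component in `G_α(T)` is infinite. (For finite `T`
there is exactly one infinite component; this is a part of the theorem.) -/
def exteriorRegion (α : Conn) (T : Set Pixel) : Set Pixel :=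
  {z | perimeterImage α T z = some .white ∧
    ((charGraph α T).connectedComponentMk z).supp.Infinite}

/-- The exterior site perimeter `P_α^ext(T)`. -/
def extSitePerimeter (α : Conn) (T : Set Pixel) : Set Pixel :=
  {z | z ∈ sitePerimeter α T ∧ ∃ e ∈ exteriorRegion α T, (adjGraph α).Adj z e}

/-- The least length of a nondegenerate cycle. It excludes the `8`-connected triangles and the
`2 × 2` square as a `4`-connected cycle, which surround no pixel. -/
def Conn.minCycleLength : Conn → ℕ
  | .four => 8
  | .eight => 4

/-- `S` is a simple `β`-connected cycle: the graph that `β`-adjacency induces on `S` is a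
(chordless) cycle, of nondegenerate length. -/
def IsSimpleCycle (β : Conn) (S : Set Pixel) : Prop :=
  ∃ n : ℕ, β.minCycleLength ≤ n ∧
    Nonempty ((adjGraph β).induce S ≃g SimpleGraph.cycleGraph n)

/-!
Whether a lattice walk crosses the horizontal ray of a point `p` an even or odd number of times
changes in a controlled way as `p` moves to a neighbour: closed walks keep their parity as long as
they are not met. It follows that two disjointly drawn connected sets of pixels cannot have
neighbours of a common pixel `s` that alternate around `s`.

Let `S` be the exterior perimeter of `T`, and `E` the exterior region. Around a pixel `s` of `S`,
each of the two arcs from a neighbour in `E` to a neighbour in `T` contains a `β`-neighbour of `s`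
in `S`. Two such neighbours always lie on different arcs: otherwise the first one together with `T`
would alternate around `s` with the second one together with `E`. So every pixel of `S` has exactly
two `β`-neighbours in `S`. If the cycle of `S` through `s` missed a pixel `z` of `S`, the connected
set `T ∪ E ∪ {z}` would alternate with it around `s`; hence `S` is a single cycle. The pixels just
beyond the extreme points of `T` in the four directions account for the minimal length.
-/

open SimpleGraph

section CycleGraphs

variable {V W : Type*} {G : SimpleGraph V} {H : SimpleGraph W}

theorem exists_isHamiltonianCycle_of_connected [Finite V] [DecidableEq V]
    (hconn : G.Connected) (hdeg : ∀ v, (G.neighborSet v).ncard = 2) :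
    ∃ (v : V) (p : G.Walk v v), p.IsHamiltonianCycle := by
  obtain ⟨v⟩ := hconn.nonempty
  have hne : (G.neighborSet v).Nonempty := Set.nonempty_of_ncard_ne_zero (by simp [hdeg])
  have hcyc : G.IsCycles := fun v _ => hdeg v
  obtain ⟨p, hp, hverts⟩ := hcyc.exists_cycle_toSubgraph_verts_eq_connectedComponentSupp
    (c := G.connectedComponentMk v) rfl hne
  have hmem (x : V) : x ∈ p.support := by
    rw [← Walk.mem_verts_toSubgraph, hverts]
    exact ConnectedComponent.sound (hconn.preconnected x v)
  refine ⟨v, p, p.isHamiltonianCycle_iff_isCycle_and_support_count_tail_eq_one.2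
    ⟨hp, fun x => List.count_eq_one_of_mem hp.support_nodup ?_⟩⟩
  rcases p.mem_support_iff.1 (hmem x) with rfl | hx
  · exact Walk.end_mem_tail_support hp.not_nil
  · exact hx

theorem hom_adj_iff_of_ncard_neighborSet_le (f : G →g H) (hf : Function.Injective f) {a b : V}
    (hfin : (H.neighborSet (f a)).Finite)
    (hdeg : (H.neighborSet (f a)).ncard ≤ (G.neighborSet a).ncard) :
    H.Adj (f a) (f b) ↔ G.Adj a b := by
  refine ⟨fun hab => ?_, f.map_adj⟩
  have himage : f '' G.neighborSet a = H.neighborSet (f a) := by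
    refine Set.eq_of_subset_of_ncard_le (Set.image_subset_iff.2 fun c hc => f.map_adj hc) ?_ hfin
    rwa [Set.ncard_image_of_injective _ hf]
  obtain ⟨c, hc, hcb⟩ : f b ∈ f '' G.neighborSet a := himage ▸ hab
  exact hf hcb ▸ hc

theorem ncard_neighborSet_cycleGraph {n : ℕ} (hn : 3 ≤ n) (a : Fin n) :
    ((cycleGraph n).neighborSet a).ncard = 2 := by
  obtain ⟨n, rfl⟩ := Nat.exists_eq_add_of_le' hn
  rw [← cycleGraph_degree_three_le (v := a), ← card_neighborSet_eq_degree,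
    Set.ncard_eq_toFinset_card', Set.toFinset_card]

theorem nonempty_iso_cycleGraph_of_connected [Finite V] (hconn : G.Connected)
    (hdeg : ∀ v, (G.neighborSet v).ncard = 2) : Nonempty (G ≃g cycleGraph (Nat.card V)) := by
  classical
  have := Fintype.ofFinite V
  obtain ⟨v, p, hp⟩ := exists_isHamiltonianCycle_of_connected hconn hdeg
  have hlength : p.length = Nat.card V := by rw [hp.length_eq, Nat.card_eq_fintype_card]
  have hcard : 3 ≤ Nat.card V := hlength ▸ hp.isCycle.three_le_length
  obtain ⟨f⟩ := (cycleGraph_isContained_iff hcard).2 ⟨v, p, hp.isCycle, hlength⟩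
  have hbij : Function.Bijective f.toHom :=
    (Nat.bijective_iff_injective_and_card _).2 ⟨f.injective, by simp⟩
  refine ⟨RelIso.symm ⟨Equiv.ofBijective _ hbij,
    hom_adj_iff_of_ncard_neighborSet_le _ f.injective (Set.toFinite _) ?_⟩⟩
  rw [hdeg, ncard_neighborSet_cycleGraph hcard]

theorem exists_walk_notMem_support_of_isCycles [Finite V] (hG : G.IsCycles) {v a b : V}
    (ha : G.Adj v a) (hb : G.Adj v b) (hab : a ≠ b) : ∃ p : G.Walk a b, v ∉ p.support := by
  classical
  obtain ⟨p, hp⟩ := (hG.reachable_deleteEdges hb).exists_isPath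
  cases p with
  | nil => exact (hb.ne rfl).elim
  | @cons _ c _ hvc p =>
    obtain ⟨hGvc, hc⟩ := deleteEdges_adj.1 hvc
    have hbc : b ≠ c := by
      rintro rfl
      exact hc rfl
    obtain rfl : c = a := (hG.existsUnique_ne_adj hb).unique ⟨hbc, hGvc⟩ ⟨hab.symm, ha⟩
    exact ⟨p.mapLe (deleteEdges_le _), by simpa using (Walk.cons_isPath_iff _ _).1 hp |>.2⟩

end CycleGraphs

section Adjacency

variable {x y z w : Pixel}

theorem adj_eight_iff : (adjGraph .eight).Adj x y ↔
    x ≠ y ∧ x.1 ≤ y.1 + 1 ∧ y.1 ≤ x.1 + 1 ∧ x.2 ≤ y.2 + 1 ∧ y.2 ≤ x.2 + 1 := by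
  simp only [adjGraph, Conn.dist, ne_eq, Prod.ext_iff]
  grind

theorem adj_four_iff : (adjGraph .four).Adj x y ↔
    (x.1 = y.1 ∧ (x.2 = y.2 + 1 ∨ y.2 = x.2 + 1)) ∨
    (x.2 = y.2 ∧ (x.1 = y.1 + 1 ∨ y.1 = x.1 + 1)) := by
  simp only [adjGraph, Conn.dist]
  grind

theorem adjGraph_four_le_eight : adjGraph .four ≤ adjGraph .eight := by
  intro x y hxy
  rw [adj_four_iff] at hxy
  rw [adj_eight_iff, ne_eq, Prod.ext_iff]
  omega

theorem adjGraph_le_eight (α : Conn) : adjGraph α ≤ adjGraph .eight := by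
  cases α
  exacts [adjGraph_four_le_eight, le_rfl]

theorem adjGraph_four_le (α : Conn) : adjGraph .four ≤ adjGraph α := by
  cases α
  exacts [le_rfl, adjGraph_four_le_eight]

theorem adj_add_left (α : Conn) (s x y : Pixel) :
    (adjGraph α).Adj (s + x) (s + y) ↔ (adjGraph α).Adj x y := by
  cases α <;> simp [adjGraph, Conn.dist]

theorem adj_self_add (α : Conn) (s x : Pixel) :
    (adjGraph α).Adj s (s + x) ↔ (adjGraph α).Adj 0 x := by
  simpa using adj_add_left α s 0 x

theorem add_ne_add_of_adj_four (hxy : (adjGraph .four).Adj x y) (hzw : (adjGraph .eight).Adj z w)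
    (hxz : x ≠ z) (hyz : y ≠ z) : x + y ≠ z + w := by
  rw [adj_four_iff] at hxy
  rw [adj_eight_iff] at hzw
  simp only [ne_eq, Prod.ext_iff, Prod.fst_add, Prod.snd_add] at *
  omega

theorem add_ne_add_of_not_adj_eight (hxy : (adjGraph .eight).Adj x y)
    (hzw : (adjGraph .eight).Adj z w) (hxz : x ≠ z) (hnadj : ¬ (adjGraph .eight).Adj x z) :
    x + y ≠ z + w := by
  rw [adj_eight_iff] at *
  simp only [ne_eq, Prod.ext_iff, Prod.fst_add, Prod.snd_add] at *
  omega

end Adjacency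

section Parity

/-- `H` and `K` have no common vertex that is an endpoint of an edge in both, and no edge of `H`
has the midpoint of an edge of `K`. For subgraphs of `adjGraph .eight` this says that `H` and `K`
are disjoint when drawn with straight edges: two edges without a common endpoint can only meet as
the two diagonals of a unit square. -/
def Noncrossing (H K : SimpleGraph Pixel) : Prop :=
  ∀ ⦃x y z w⦄, H.Adj x y → K.Adj z w → x ≠ z ∧ x + y ≠ z + w

/-- Whether the segment `uv` crosses the horizontal ray that starts slightly above `p` and goes
to the right. -/
def rayCross (p u v : Pixel) : ZMod 2 :=
  if ((u.2 = p.2 ∧ v.2 = p.2 + 1) ∨ (v.2 = p.2 ∧ u.2 = p.2 + 1)) ∧ 2 * p.1 < u.1 + v.1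
  then 1 else 0

/-- The potential whose increment along an edge is the change of `rayCross` on that edge as the
base point of the ray moves from `p` to `q`. -/
def rayShift (p q u : Pixel) : ZMod 2 :=
  if (q.2 = p.2 + 1 ∧ u.2 = q.2 ∧ q.1 < u.1) ∨ (p.2 = q.2 + 1 ∧ u.2 = p.2 ∧ p.1 < u.1)
  then 1 else 0

/-- The parity of the number of steps of a walk that cross the ray of `p`. -/
def walkCross (p : Pixel) {H : SimpleGraph Pixel} {a b : Pixel} (w : H.Walk a b) : ZMod 2 :=
  (w.darts.map fun d => rayCross p d.fst d.snd).sum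

variable {H K H' : SimpleGraph Pixel} {a b c p q u v : Pixel}

theorem Noncrossing.symm (h : Noncrossing H K) : Noncrossing K H :=
  fun _ _ _ _ hK hH => ⟨(h hH hK).1.symm, (h hH hK).2.symm⟩

theorem Noncrossing.sup_left (h : Noncrossing H K) (h' : Noncrossing H' K) :
    Noncrossing (H ⊔ H') K := by
  rintro x y z w (hxy | hxy) hzw
  exacts [h hxy hzw, h' hxy hzw]

theorem Noncrossing.sup_right (h : Noncrossing K H) (h' : Noncrossing K H') :
    Noncrossing K (H ⊔ H') :=
  (h.symm.sup_left h'.symm).symm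

theorem zmod_two_ite_add {P Q R S : Prop} [Decidable P] [Decidable Q] [Decidable R] [Decidable S]
    (h : (P ↔ Q) ↔ (R ↔ S)) :
    ((if P then 1 else 0) + (if Q then 1 else 0) : ZMod 2) =
      (if R then 1 else 0) + (if S then 1 else 0) := by
  split_ifs <;> first | decide | (exfalso; tauto)

theorem rayCross_add_rayCross (hpq : (adjGraph .eight).Adj p q) (huv : (adjGraph .eight).Adj u v)
    (hup : u ≠ p) (huq : u ≠ q) (hvp : v ≠ p) (hvq : v ≠ q) (hmid : u + v ≠ p + q) :
    rayCross p u v + rayCross q u v = rayShift p q u + rayShift p q v := by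
  obtain ⟨p₁, p₂⟩ := p
  obtain ⟨q₁, q₂⟩ := q
  obtain ⟨u₁, u₂⟩ := u
  obtain ⟨v₁, v₂⟩ := v
  rw [adj_eight_iff] at hpq huv
  simp only [ne_eq, Prod.mk.injEq, Prod.mk_add_mk] at *
  apply zmod_two_ite_add
  have hpq₂ : q₂ = p₂ ∨ q₂ = p₂ + 1 ∨ p₂ = q₂ + 1 := by omega
  have huv₂ : u₂ = v₂ ∨ u₂ = v₂ + 1 ∨ v₂ = u₂ + 1 := by omega
  rcases hpq₂ with rfl | rfl | rfl <;> rcases huv₂ with rfl | rfl | rfl <;> grind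

@[simp]
theorem walkCross_nil : walkCross p (Walk.nil : H.Walk a a) = 0 :=
  rfl

@[simp]
theorem walkCross_cons (h : H.Adj a c) (w : H.Walk c b) :
    walkCross p (Walk.cons h w) = rayCross p a c + walkCross p w := by
  simp [walkCross]

@[simp]
theorem walkCross_mapLe (hle : H ≤ K) (w : H.Walk a b) :
    walkCross p (w.mapLe hle) = walkCross p w := by
  induction w with
  | nil => rfl
  | cons h w ih => simp_all

theorem walkCross_add_walkCross (hH : H ≤ adjGraph .eight) (hK : K ≤ adjGraph .eight)
    (hHK : Noncrossing H K) (hpq : K.Adj p q) (w : H.Walk a b) :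
    walkCross p w + walkCross q w = rayShift p q a + rayShift p q b := by
  induction w with
  | nil => simp [CharTwo.add_self_eq_zero]
  | @cons a c b hac w ih =>
    have hstep := rayCross_add_rayCross (hK hpq) (hH hac) (hHK hac hpq).1 (hHK hac hpq.symm).1
      (hHK hac.symm hpq).1 (hHK hac.symm hpq.symm).1 (hHK hac hpq).2
    simp only [walkCross_cons]
    linear_combination hstep + ih + CharTwo.add_self_eq_zero (rayShift p q c)

theorem walkCross_eq_of_reachable (hH : H ≤ adjGraph .eight) (hK : K ≤ adjGraph .eight)
    (hHK : Noncrossing H K) (hpq : K.Reachable p q) (w : H.Walk a a) :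
    walkCross p w = walkCross q w := by
  obtain ⟨r⟩ := hpq
  induction r with
  | nil => rfl
  | cons hpc _ ih =>
    rw [← ih, ← sub_eq_zero, CharTwo.sub_eq_add, walkCross_add_walkCross hH hK hHK hpc w,
      CharTwo.add_self_eq_zero]

theorem rayCross_add_left (s p u v : Pixel) :
    rayCross (s + p) (s + u) (s + v) = rayCross p u v := by
  refine if_congr ?_ rfl rfl
  simp only [Prod.fst_add, Prod.snd_add]
  omega

theorem rayShift_add_left (s p q u : Pixel) :
    rayShift (s + p) (s + q) (s + u) = rayShift p q u := by
  refine if_congr ?_ rfl rfl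
  simp only [Prod.fst_add, Prod.snd_add]
  omega

end Parity

section Alternation

/-- The eight neighbours of the origin, counterclockwise from the east. -/
def compass : Fin 8 → Pixel :=
  ![(1, 0), (1, 1), (0, 1), (-1, 1), (-1, 0), (-1, -1), (0, -1), (1, -1)]

theorem compass_injective : Function.Injective compass := by
  decide

theorem adj_eight_iff_exists_compass {s x : Pixel} :
    (adjGraph .eight).Adj s x ↔ ∃ i, x = s + compass i := by
  obtain ⟨s₁, s₂⟩ := s
  obtain ⟨x₁, x₂⟩ := x
  simp only [adj_eight_iff, Fin.exists_fin_succ, compass]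
  simp only [ne_eq, Prod.mk.injEq, Fin.isValue, Fin.succ_zero_eq_one, Fin.succ_one_eq_two,
    Fin.reduceSucc, Matrix.cons_val_zero, Matrix.cons_val_one, Matrix.cons_val,
    Matrix.cons_val_succ, Matrix.cons_val_fin_one, Prod.mk_add_mk, IsEmpty.exists_iff,
    or_false]
  omega

theorem compass_adj_compass_add (α : Conn) (i : Fin 8) {d : Fin 8} (hd : d = 1 ∨ d = -1) :
    (adjGraph α).Adj (compass i) (compass (i + d)) := by
  refine adjGraph_four_le α (adj_four_iff.2 ?_)
  revert i
  rcases hd with rfl | rfl <;> decide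

theorem adj_compass_add_or (α : Conn) (i : Fin 8) {d : Fin 8} (hd : d = 1 ∨ d = -1) :
    (adjGraph α.dual).Adj 0 (compass (i + d)) ∨
      (adjGraph α).Adj (compass i) (compass (i + d + d)) ∧
        (adjGraph α.dual).Adj 0 (compass (i + d + d)) := by
  revert i
  rcases hd with rfl | rfl <;> cases α <;> simp only [adj_eight_iff, adj_four_iff, Conn.dual] <;>
    decide

/-- On a circle, the points `u` and `v` lie on different sides of the chord `pq`. -/
def Alternates {C : Type*} [CircularOrder C] (p q u v : C) : Prop :=
  sbtw p u q ∧ sbtw q v p ∨ sbtw p v q ∧ sbtw q u p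

theorem alternates_or_alternates_or_alternates {n : ℕ} {e t x y : Fin n} (het : e ≠ t)
    (hex : e ≠ x) (hey : e ≠ y) (htx : t ≠ x) (hty : t ≠ y) (hxy : x ≠ y) :
    Alternates e t x y ∨ Alternates e y x t ∨ Alternates e x y t := by
  simp only [Alternates, Fin.sbtw_iff]
  grind

theorem not_alternates_of_alternates_of_alternates {n : ℕ} {p q a b c : Fin n}
    (hab : Alternates p q a b) (hac : Alternates p q a c) : ¬ Alternates p q b c := by
  simp only [Alternates, Fin.sbtw_iff] at *
  omega

theorem crossing_parity_of_alternates : ∀ p q u v : Fin 8, Alternates p q u v →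
    rayCross (compass p) (compass u) 0 + rayCross (compass p) 0 (compass v) +
    (rayCross (compass q) (compass u) 0 + rayCross (compass q) 0 (compass v)) +
    (rayShift (compass p) 0 (compass v) + rayShift (compass p) 0 (compass u) +
    (rayShift 0 (compass q) (compass v) + rayShift 0 (compass q) (compass u))) = 1 := by
  simp only [Alternates, Fin.sbtw_iff]
  decide +kernel

variable {H K Hs Ks : SimpleGraph Pixel} {s : Pixel} {p q u v : Fin 8}

theorem not_alternates (hH : H ≤ adjGraph .eight) (hHs : Hs ≤ adjGraph .eight)
    (hK : K ≤ adjGraph .eight) (hKs : Ks ≤ adjGraph .eight) (hHK : Noncrossing H K)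
    (hHsK : Noncrossing Hs K) (hHKs : Noncrossing H Ks)
    (hsu : Hs.Adj s (s + compass u)) (hsv : Hs.Adj s (s + compass v))
    (hsp : Ks.Adj s (s + compass p)) (hsq : Ks.Adj s (s + compass q))
    (hvu : H.Reachable (s + compass v) (s + compass u))
    (hpq : K.Reachable (s + compass p) (s + compass q)) : ¬ Alternates p q u v := by
  intro halt
  obtain ⟨R⟩ := hvu
  let loop : (H ⊔ Hs).Walk (s + compass u) (s + compass u) :=
    .cons (.inr hsu.symm) (.cons (.inr hsv) (R.mapLe le_sup_left))
  have hloop := walkCross_eq_of_reachable (sup_le hH hHs) hK (hHK.sup_left hHsK) hpq loop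
  have hcrossp := walkCross_add_walkCross hH hKs hHKs hsp.symm R
  have hcrossq := walkCross_add_walkCross hH hKs hHKs hsq R
  have hlocal := crossing_parity_of_alternates p q u v halt
  simp only [← rayCross_add_left s (compass _), ← rayShift_add_left s (compass _),
    ← rayShift_add_left s 0, add_zero] at hlocal
  simp only [loop, walkCross_cons, walkCross_mapLe] at hloop
  rw [← sub_eq_zero, CharTwo.sub_eq_add] at hloop
  have hcontra : (1 : ZMod 2) = 0 := by
    rw [← hlocal]
    linear_combination hloop - hcrossp - hcrossq + CharTwo.add_self_eq_zero (walkCross s R)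
  exact one_ne_zero hcontra

end Alternation

section Interface

/-- The graph on all pixels of `α`-adjacency between points of `A`. -/
def within (α : Conn) (A : Set Pixel) : SimpleGraph Pixel :=
  ((adjGraph α).induce A).spanningCoe

/-- `S` is the common boundary of the `α`-connected sets `T` and `E`, which are disjoint and not
`α`-adjacent: every point of `S` is adjacent to both, and every neighbour of `E` outside `E` is
in `S`. (`T` may have further neighbours, in its holes.) -/
structure IsInterface (α : Conn) (T E S : Set Pixel) : Prop where
  connected_left : ((adjGraph α).induce T).Connected
  connected_right : ((adjGraph α).induce E).Connected
  disjoint : Disjoint T E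
  disjoint_left : Disjoint S T
  disjoint_right : Disjoint S E
  not_adj : ∀ t ∈ T, ∀ e ∈ E, ¬ (adjGraph α).Adj t e
  exists_left : ∀ s ∈ S, ∃ t ∈ T, (adjGraph α).Adj s t
  exists_right : ∀ s ∈ S, ∃ e ∈ E, (adjGraph α).Adj s e
  mem_or_mem : ∀ e ∈ E, ∀ z, (adjGraph α).Adj e z → z ∈ E ∨ z ∈ S

variable {α : Conn} {A B T E S : Set Pixel} {s x y z : Pixel}

theorem within_adj : (within α A).Adj x y ↔ (adjGraph α).Adj x y ∧ x ∈ A ∧ y ∈ A := by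
  rw [within, map_adj]
  refine ⟨?_, fun ⟨hxy, hx, hy⟩ => ⟨⟨x, hx⟩, ⟨y, hy⟩, hxy, rfl, rfl⟩⟩
  rintro ⟨a, b, hab, rfl, rfl⟩
  exact ⟨hab, a.2, b.2⟩

theorem within_le_eight (α : Conn) (A : Set Pixel) : within α A ≤ adjGraph .eight :=
  fun _ _ hxy => adjGraph_le_eight α (within_adj.1 hxy).1

theorem within_reachable (hA : ((adjGraph α).induce A).Connected) (hx : x ∈ A) (hy : y ∈ A) :
    (within α A).Reachable x y :=
  (hA.preconnected ⟨x, hx⟩ ⟨y, hy⟩).map (Embedding.spanningCoe _).toHom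

theorem connected_induce_insert {V : Type*} {G : SimpleGraph V} {A : Set V} {x y : V}
    (hA : (G.induce A).Connected) (hy : y ∈ A) (hxy : G.Adj x y) :
    (G.induce (insert x A)).Connected :=
  connected_induce_union (s := {x}) .of_subsingleton hA.preconnected rfl hy hxy

theorem noncrossing_within_dual (hAB : Disjoint A B) :
    Noncrossing (within α A) (within α.dual B) := by
  intro x y z w hxy hzw
  rw [within_adj] at hxy hzw
  obtain ⟨hxy, hx, hy⟩ := hxy
  obtain ⟨hzw, hz, hw⟩ := hzw
  refine ⟨hAB.ne_of_mem hx hz, ?_⟩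
  cases α with
  | four => exact add_ne_add_of_adj_four hxy hzw (hAB.ne_of_mem hx hz) (hAB.ne_of_mem hy hz)
  | eight =>
    exact (add_ne_add_of_adj_four hzw hxy (hAB.ne_of_mem hx hz).symm
      (hAB.ne_of_mem hx hw).symm).symm

theorem mem_or_mem_of_within_insert_adj (hyz : (within α (insert x A)).Adj y z) :
    y ∈ A ∨ z ∈ A := by
  obtain ⟨hyz, rfl | hy, rfl | hz⟩ := within_adj.1 hyz
  · exact (hyz.ne rfl).elim
  all_goals tauto

theorem noncrossing_within_insert (hAB : Disjoint A B)
    (hnadj : ∀ a ∈ A, ∀ b ∈ B, ¬ (adjGraph α).Adj a b) (hxy : Disjoint (insert x A) (insert y B)) :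
    Noncrossing (within α (insert x A)) (within α (insert y B)) := by
  intro a a' b b' ha hb
  have haA := mem_or_mem_of_within_insert_adj ha
  have hbB := mem_or_mem_of_within_insert_adj hb
  rw [within_adj] at ha hb
  refine ⟨hxy.ne_of_mem ha.2.1 hb.2.1, ?_⟩
  cases α with
  | four =>
    exact add_ne_add_of_adj_four ha.1 (adjGraph_four_le_eight hb.1)
      (hxy.ne_of_mem ha.2.1 hb.2.1) (hxy.ne_of_mem ha.2.2 hb.2.1)
  | eight =>
    have hne {c c' d d'} (hc : c ∈ A) (hd : d ∈ B) (hcc' : (adjGraph .eight).Adj c c')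
        (hdd' : (adjGraph .eight).Adj d d') : c + c' ≠ d + d' :=
      add_ne_add_of_not_adj_eight hcc' hdd' (hAB.ne_of_mem hc hd) (hnadj c hc d hd)
    obtain haA | haA := haA <;> obtain hbB | hbB := hbB
    · exact hne haA hbB ha.1 hb.1
    · exact add_comm b b' ▸ hne haA hbB ha.1 hb.1.symm
    · exact add_comm a a' ▸ hne haA hbB ha.1.symm hb.1
    · exact add_comm a a' ▸ add_comm b b' ▸ hne haA hbB ha.1.symm hb.1.symm

theorem disjoint_pair_insert {V : Type*} {S A : Set V} {s x y : V} (hSA : Disjoint S A)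
    (hs : s ∈ S) (hx : x ∈ S) (hsy : s ≠ y) (hxy : x ≠ y) : Disjoint {s, x} (insert y A) := by
  have hsA := hSA.notMem_of_mem_left hs
  have hxA := hSA.notMem_of_mem_left hx
  simp [*, hsy.symm, hxy.symm]

namespace IsInterface

theorem disjoint_insert_insert (h : IsInterface α T E S) (hx : x ∈ S) (hy : y ∈ S) (hxy : x ≠ y) :
    Disjoint (insert x T) (insert y E) := by
  have hxE := h.disjoint_right.notMem_of_mem_left hx
  have hyT := h.disjoint_left.notMem_of_mem_left hy
  simp [h.disjoint, hxy.symm, hxE, hyT]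

theorem noncrossing_insert (h : IsInterface α T E S) (hx : x ∈ S) (hy : y ∈ S) (hxy : x ≠ y) :
    Noncrossing (within α (insert x T)) (within α (insert y E)) :=
  noncrossing_within_insert h.disjoint h.not_adj (h.disjoint_insert_insert hx hy hxy)

theorem not_alternates {e t x y : Fin 8} (h : IsInterface α T E S) (hs : s ∈ S)
    (he : s + compass e ∈ E) (ht : s + compass t ∈ T) (hx : s + compass x ∈ S)
    (hy : s + compass y ∈ S) (hse : (adjGraph α).Adj s (s + compass e))
    (hst : (adjGraph α).Adj s (s + compass t)) (hsx : (adjGraph α.dual).Adj s (s + compass x))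
    (hsy : (adjGraph α.dual).Adj s (s + compass y)) (hxy : s + compass x ≠ s + compass y) :
    ¬ Alternates e y x t := by
  obtain ⟨t', ht', hxt'⟩ := h.exists_left _ hx
  obtain ⟨e', he', hye'⟩ := h.exists_right _ hy
  have hdisjx := disjoint_pair_insert h.disjoint_right hs hx hsy.ne hxy
  have hdisjy := disjoint_pair_insert h.disjoint_left hs hy hsx.ne hxy.symm
  refine _root_.not_alternates
    (H := within α (insert (s + compass x) T)) (K := within α (insert (s + compass y) E))
    (Hs := within α (insert s T) ⊔ within α.dual {s, s + compass x})
    (Ks := within α (insert s E) ⊔ within α.dual {s, s + compass y})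
    (within_le_eight _ _) (sup_le (within_le_eight _ _) (within_le_eight _ _))
    (within_le_eight _ _) (sup_le (within_le_eight _ _) (within_le_eight _ _))
    (h.noncrossing_insert hx hy hxy)
    ((h.noncrossing_insert hs hy hsy.ne).sup_left (noncrossing_within_dual hdisjx.symm).symm)
    ((h.noncrossing_insert hx hs hsx.ne').sup_right (noncrossing_within_dual hdisjy.symm))
    (.inr ?_) (.inl ?_) (.inl ?_) (.inr ?_)
    (within_reachable (connected_induce_insert h.connected_left ht' hxt') (.inr ht) (.inl rfl))
    (within_reachable (connected_induce_insert h.connected_right he' hye') (.inr he) (.inl rfl))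
  all_goals simp [within_adj, *]

theorem alternates {e t x y : Fin 8} (h : IsInterface α T E S) (hs : s ∈ S)
    (he : s + compass e ∈ E) (ht : s + compass t ∈ T) (hx : s + compass x ∈ S)
    (hy : s + compass y ∈ S) (hse : (adjGraph α).Adj s (s + compass e))
    (hst : (adjGraph α).Adj s (s + compass t)) (hsx : (adjGraph α.dual).Adj s (s + compass x))
    (hsy : (adjGraph α.dual).Adj s (s + compass y)) (hxy : s + compass x ≠ s + compass y) :
    Alternates e t x y := by
  have hne {i j : Fin 8} (hij : s + compass i ≠ s + compass j) : i ≠ j :=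
    fun eq => hij (congrArg (s + compass ·) eq)
  have hSE {z w} := h.disjoint_right.symm.ne_of_mem (a := z) (b := w)
  have hST {z w} := h.disjoint_left.symm.ne_of_mem (a := z) (b := w)
  refine (alternates_or_alternates_or_alternates (hne (h.disjoint.symm.ne_of_mem he ht))
    (hne (hSE he hx)) (hne (hSE he hy)) (hne (hST ht hx)) (hne (hST ht hy)) (hne hxy)).resolve_right
    (not_or.2 ⟨?_, ?_⟩)
  · exact h.not_alternates hs he ht hx hy hse hst hsx hsy hxy
  · exact h.not_alternates hs he ht hy hx hse hst hsy hsx hxy.symm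

theorem eq_or_eq_or_eq_of_adj (h : IsInterface α T E S) {a b c : Pixel} (hs : s ∈ S) (ha : a ∈ S)
    (hb : b ∈ S) (hc : c ∈ S) (hsa : (adjGraph α.dual).Adj s a) (hsb : (adjGraph α.dual).Adj s b)
    (hsc : (adjGraph α.dual).Adj s c) : a = b ∨ a = c ∨ b = c := by
  by_contra! ⟨hab, hac, hbc⟩
  obtain ⟨t, ht, hst⟩ := h.exists_left _ hs
  obtain ⟨e, he, hse⟩ := h.exists_right _ hs
  obtain ⟨i, rfl⟩ := adj_eight_iff_exists_compass.1 (adjGraph_le_eight _ hse)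
  obtain ⟨j, rfl⟩ := adj_eight_iff_exists_compass.1 (adjGraph_le_eight _ hst)
  obtain ⟨k, rfl⟩ := adj_eight_iff_exists_compass.1 (adjGraph_le_eight _ hsa)
  obtain ⟨l, rfl⟩ := adj_eight_iff_exists_compass.1 (adjGraph_le_eight _ hsb)
  obtain ⟨m, rfl⟩ := adj_eight_iff_exists_compass.1 (adjGraph_le_eight _ hsc)
  exact not_alternates_of_alternates_of_alternates
    (h.alternates hs he ht ha hb hse hst hsa hsb hab)
    (h.alternates hs he ht ha hc hse hst hsa hsc hac)
    (h.alternates hs he ht hb hc hse hst hsb hsc hbc)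

theorem exists_mem_arc (h : IsInterface α T E S) {r : ℕ → Pixel}
    (hr : ∀ k, (adjGraph α).Adj (r k) (r (k + 1)))
    (hs : ∀ k, (adjGraph α.dual).Adj s (r (k + 1)) ∨
      (adjGraph α).Adj (r k) (r (k + 2)) ∧ (adjGraph α.dual).Adj s (r (k + 2)))
    {m : ℕ} (hzero : r 0 ∈ E) (hm : r m ∈ T) :
    ∃ k, 0 < k ∧ k < m ∧ r k ∈ S ∧ (adjGraph α.dual).Adj s (r k) := by
  classical
  -- The walk leaves `E` into `S` right after its last point in `E`.
  let k := Nat.findGreatest (r · ∈ E) m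
  have hk : r k ∈ E := Nat.findGreatest_spec (P := (r · ∈ E)) m.zero_le hzero
  have hkm : k ≤ m := Nat.findGreatest_le m
  have hmem {j : ℕ} (hj : k < j) (hjm : j ≤ m) (hadj : (adjGraph α).Adj (r k) (r j)) : r j ∈ S :=
    (h.mem_or_mem _ hk _ hadj).resolve_left (Nat.findGreatest_is_greatest hj hjm)
  have hkm₀ : k ≠ m := fun eq => h.disjoint.ne_of_mem hm hk (congrArg r eq).symm
  have hkm₁ : k + 1 ≠ m := fun eq => h.not_adj _ hm _ hk (eq ▸ (hr k).symm)
  rcases hs k with hadj | ⟨hstep, hadj⟩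
  · exact ⟨k + 1, by omega, by omega, hmem (by omega) (by omega) (hr k), hadj⟩
  · have hS := hmem (by omega) (by omega) hstep
    have hkm₂ : k + 2 ≠ m := fun eq => h.disjoint_left.ne_of_mem hS hm (congrArg r eq)
    exact ⟨k + 2, by omega, by omega, hS, hadj⟩

open Fin.NatCast Fin.CommRing in
theorem exists_mem_compass_arc (h : IsInterface α T E S) {i d : Fin 8} (hd : d = 1 ∨ d = -1) {m : ℕ}
    (hE : s + compass i ∈ E) (hT : s + compass (i + m * d) ∈ T) :
    ∃ k : ℕ, 0 < k ∧ k < m ∧ s + compass (i + k * d) ∈ S ∧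
      (adjGraph α.dual).Adj s (s + compass (i + k * d)) := by
  have hsucc (k : ℕ) : i + (k + 1 : ℕ) * d = i + k * d + d := by push_cast; ring
  have hsucc₂ (k : ℕ) : i + (k + 2 : ℕ) * d = i + k * d + d + d := by push_cast; ring
  refine h.exists_mem_arc (r := fun k => s + compass (i + k * d)) (fun k => ?_) (fun k => ?_)
    (by simpa using hE) hT
  · rw [hsucc, adj_add_left]
    exact compass_adj_compass_add α _ hd
  · rw [hsucc, hsucc₂, adj_add_left, adj_self_add, adj_self_add]
    exact adj_compass_add_or α _ hd

open Fin.NatCast Fin.CommRing in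
theorem exists_adj_adj (h : IsInterface α T E S) (hs : s ∈ S) :
    ∃ a ∈ S, ∃ b ∈ S, a ≠ b ∧ (adjGraph α.dual).Adj s a ∧ (adjGraph α.dual).Adj s b := by
  obtain ⟨t, ht, hst⟩ := h.exists_left _ hs
  obtain ⟨e, he, hse⟩ := h.exists_right _ hs
  have hte := h.disjoint.ne_of_mem ht he
  obtain ⟨i, rfl⟩ := adj_eight_iff_exists_compass.1 (adjGraph_le_eight _ hse)
  obtain ⟨j, rfl⟩ := adj_eight_iff_exists_compass.1 (adjGraph_le_eight _ hst)
  obtain ⟨k, hk, hkm, hkS, hsk⟩ := h.exists_mem_compass_arc (m := (j - i).val) (.inl rfl) he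
    (by simpa using ht)
  obtain ⟨l, hl, hlm, hlS, hsl⟩ := h.exists_mem_compass_arc (m := (i - j).val) (.inr rfl) he
    (by simpa using ht)
  refine ⟨_, hkS, _, hlS, fun heq => ?_, hsk, hsl⟩
  have hkl : ((k + l : ℕ) : Fin 8) = 0 := by
    push_cast
    linear_combination compass_injective (add_left_cancel heq)
  have hle := Nat.le_of_dvd (by omega) (Fin.natCast_eq_zero.1 hkl)
  omega

theorem ncard_neighborSet (h : IsInterface α T E S) (s : S) :
    (((adjGraph α.dual).induce S).neighborSet s).ncard = 2 := by
  obtain ⟨a, ha, b, hb, hab, hsa, hsb⟩ := h.exists_adj_adj s.2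
  refine Set.ncard_eq_two.2 ⟨⟨a, ha⟩, ⟨b, hb⟩, fun eq => hab (congrArg Subtype.val eq), ?_⟩
  ext ⟨c, hc⟩
  have hthree := h.eq_or_eq_or_eq_of_adj s.2 ha hb hc hsa hsb
  simp only [mem_neighborSet, comap_adj, Function.Embedding.subtype_apply, Set.mem_insert_iff,
    Set.mem_singleton_iff, Subtype.mk.injEq]
  refine ⟨fun hsc => ?_, ?_⟩
  · obtain eq | eq | eq := hthree hsc
    exacts [(hab eq).elim, .inl eq.symm, .inr eq.symm]
  · rintro (rfl | rfl)
    exacts [hsa, hsb]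

theorem connected_insert_union (h : IsInterface α T E S) (hs : s ∈ S) :
    ((adjGraph α).induce (insert s (T ∪ E))).Connected := by
  obtain ⟨t, ht, hst⟩ := h.exists_left _ hs
  obtain ⟨e, he, hse⟩ := h.exists_right _ hs
  have hT := connected_induce_insert h.connected_left ht hst
  rw [← Set.insert_union]
  exact connected_induce_union hT.preconnected h.connected_right.preconnected (.inl rfl) he hse

theorem mem_support_of_mem (h : IsInterface α T E S) {a b : Pixel} (hs : s ∈ S) (hz : z ∈ S)
    (hzs : z ≠ s) (hab : a ≠ b) (hsa : (adjGraph α.dual).Adj s a)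
    (hsb : (adjGraph α.dual).Adj s b) {p : (adjGraph α.dual).Walk a b} (hsp : s ∉ p.support)
    (hpS : {x | x ∈ p.support} ⊆ S) : z ∈ p.support := by
  by_contra hzp
  obtain ⟨t, ht, hst⟩ := h.exists_left _ hs
  obtain ⟨e, he, hse⟩ := h.exists_right _ hs
  obtain ⟨i, rfl⟩ := adj_eight_iff_exists_compass.1 (adjGraph_le_eight _ hse)
  obtain ⟨j, rfl⟩ := adj_eight_iff_exists_compass.1 (adjGraph_le_eight _ hst)
  obtain ⟨k, rfl⟩ := adj_eight_iff_exists_compass.1 (adjGraph_le_eight _ hsa)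
  obtain ⟨l, rfl⟩ := adj_eight_iff_exists_compass.1 (adjGraph_le_eight _ hsb)
  have hdisj : Disjoint S (T ∪ E) := h.disjoint_left.union_right h.disjoint_right
  have hnoncrossing {w : Pixel} {L : Set Pixel} (hL : L ⊆ S) (hw : w ∉ L) :
      Noncrossing (within α.dual L) (within α (insert w (T ∪ E))) :=
    (noncrossing_within_dual
      (Set.disjoint_insert_left.2 ⟨hw, (hdisj.mono_left hL).symm⟩)).symm
  refine _root_.not_alternates (within_le_eight _ _) (within_le_eight _ _) (within_le_eight _ _)
    (within_le_eight _ _) (hnoncrossing hpS hzp)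
    (hnoncrossing (Set.insert_subset hs hpS) (by simp [hzs, hzp])) (hnoncrossing hpS hsp)
    (u := k) (v := l) (p := i) (q := j) ?_ ?_ ?_ ?_
    (within_reachable p.connected_induce_support p.end_mem_support p.start_mem_support)
    (within_reachable (h.connected_insert_union hz) (.inr (.inr he)) (.inr (.inl ht)))
    (h.alternates hs he ht (hpS p.start_mem_support) (hpS p.end_mem_support) hse hst hsa hsb hab)
  all_goals simp [within_adj, *]

theorem connected (h : IsInterface α T E S) (hfin : S.Finite) (hne : S.Nonempty) :
    ((adjGraph α.dual).induce S).Connected := by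
  obtain ⟨s, hs⟩ := hne
  obtain ⟨a, ha, b, hb, hab, hsa, hsb⟩ := h.exists_adj_adj hs
  have := hfin.to_subtype
  have hcycles : ((adjGraph α.dual).induce S).IsCycles := fun v _ => h.ncard_neighborSet v
  obtain ⟨p, hsp⟩ := exists_walk_notMem_support_of_isCycles hcycles (v := ⟨s, hs⟩) (a := ⟨a, ha⟩)
    (b := ⟨b, hb⟩) hsa hsb (fun eq => hab (congrArg Subtype.val eq))
  let q := p.map (Embedding.induce S).toHom
  have hqS : {x | x ∈ q.support} ⊆ S := by
    intro x hx
    obtain ⟨y, -, rfl⟩ := List.mem_map.1 (Walk.support_map _ p ▸ hx)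
    exact y.2
  have hsq : s ∉ q.support := by
    intro hsq
    obtain ⟨y, hy, rfl⟩ := List.mem_map.1 (Walk.support_map _ p ▸ hsq)
    exact hsp hy
  have hS : insert s {x | x ∈ q.support} = S := by
    refine (Set.insert_subset hs hqS).antisymm fun z hz => or_iff_not_imp_left.2 fun hzs => ?_
    exact h.mem_support_of_mem hs hz hzs hab hsa hsb hsq hqS
  rw [← hS]
  exact connected_induce_insert q.connected_induce_support q.start_mem_support hsa

theorem isSimpleCycle (h : IsInterface α T E S) (hfin : S.Finite)
    (hmin : α.dual.minCycleLength ≤ S.ncard) : IsSimpleCycle α.dual S := by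
  have hpos : 0 < α.dual.minCycleLength := by cases α <;> decide
  have hne : S.Nonempty := Set.nonempty_of_ncard_ne_zero (by omega)
  have := hfin.to_subtype
  refine ⟨S.ncard, hmin, ?_⟩
  exact nonempty_iso_cycleGraph_of_connected (h.connected hfin hne) h.ncard_neighborSet

end IsInterface

end Interface

section Reachability

variable {V : Type*} {G : SimpleGraph V}

theorem mem_of_reachable {A : Set V} (hA : ∀ x ∈ A, ∀ y, G.Adj x y → y ∈ A) {x y : V}
    (hxy : G.Reachable x y) (hx : x ∈ A) : y ∈ A := by
  obtain ⟨w⟩ := hxy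
  induction w with
  | nil => exact hx
  | cons hadj _ ih => exact ih (hA _ hx _ hadj)

theorem reachable_of_adj_add_one {ι : Type*} [LinearOrder ι] [Add ι] [One ι] [SuccAddOrder ι]
    [NoMaxOrder ι] [IsSuccArchimedean ι] {r : ι → V}
    (hr : ∀ n, G.Adj (r n) (r (n + 1))) (m n : ι) : G.Reachable (r m) (r n) := by
  refine (hasse_preconnected_of_succ ι m n).map ⟨r, ?_⟩
  simp only [hasse_adj, Order.covBy_iff_add_one_eq]
  rintro a b (rfl | rfl)
  exacts [hr a, (hr b).symm]

theorem infinite_supp_iff_eq_connectedComponentMk [Infinite V] {B : Set V} (hB : B.Finite) {c : V}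
    (hc : ∀ z ∉ B, G.Reachable z c) (C : G.ConnectedComponent) :
    C.supp.Infinite ↔ C = G.connectedComponentMk c := by
  refine ⟨fun hC => ?_, ?_⟩
  · obtain ⟨z, hzC, hzB⟩ := hC.exists_notMem_finite hB
    exact ((C.mem_supp_iff z).1 hzC).symm.trans (ConnectedComponent.sound (hc z hzB))
  · rintro rfl
    exact hB.infinite_compl.mono fun z hz => ConnectedComponent.sound (hc z hz)

end Reachability

section Perimeter

variable {α : Conn} {T : Set Pixel} {t x y z : Pixel}

theorem IsConnComponent.connected_induce {I : BinaryImage} (hT : IsConnComponent α I T) :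
    ((adjGraph α).induce T).Connected := by
  obtain ⟨x, -, rfl⟩ := hT
  have hsupp : {y | (monochromaticGraph α I).Reachable x y} =
      ((monochromaticGraph α I).connectedComponentMk x).supp := by
    ext y
    simp [reachable_comm]
  rw [hsupp]
  have hmono : (monochromaticGraph α I).Adj ≤ (adjGraph α).Adj := fun _ _ hxy => hxy.1
  exact (ConnectedComponent.connected_toSimpleGraph _).mono fun x y hxy => hmono x y hxy

theorem charGraph_adj : (charGraph α T).Adj x y ↔
    (x ∉ sitePerimeter α T ∧ y ∉ sitePerimeter α T ∧ (adjGraph α).Adj x y) ∨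
    (x ∈ sitePerimeter α T ∧ y ∈ sitePerimeter α T ∧ (adjGraph α.dual).Adj x y) := by
  classical
  simp only [charGraph, imageGraph, perimeterImage]
  split_ifs <;> simp_all

theorem mem_exteriorRegion : z ∈ exteriorRegion α T ↔
    z ∉ sitePerimeter α T ∧ ((charGraph α T).connectedComponentMk z).supp.Infinite := by
  classical
  simp only [exteriorRegion, perimeterImage, Set.mem_ofPred_eq]
  split_ifs <;> simp_all

theorem finite_sitePerimeter (hT : T.Finite) : (sitePerimeter α T).Finite := by
  refine (Set.Finite.image2 (fun t i => t + compass i) hT Set.finite_univ).subset ?_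
  rintro z ⟨-, t, ht, hzt⟩
  obtain ⟨i, rfl⟩ := adj_eight_iff_exists_compass.1 (adjGraph_le_eight _ hzt.symm)
  exact ⟨t, ht, i, trivial, rfl⟩

theorem mem_sitePerimeter_iff_of_reachable (hxy : (charGraph α T).Reachable x y) :
    x ∈ sitePerimeter α T ↔ y ∈ sitePerimeter α T := by
  have hclosed : ∀ x ∈ sitePerimeter α T, ∀ y, (charGraph α T).Adj x y → y ∈ sitePerimeter α T := by
    intro x hx y hxy
    rw [charGraph_adj] at hxy
    tauto
  exact ⟨mem_of_reachable hclosed hxy, mem_of_reachable hclosed hxy.symm⟩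

theorem charGraph_adj_of_adj_four (hx : x ∉ sitePerimeter α T) (hy : y ∉ sitePerimeter α T)
    (hxy : (adjGraph .four).Adj x y) : (charGraph α T).Adj x y :=
  charGraph_adj.2 (.inl ⟨hx, hy, adjGraph_four_le α hxy⟩)

theorem exists_finite_forall_notMem_reachable (hT : T.Finite) :
    ∃ B : Set Pixel, B.Finite ∧ ∃ c ∉ sitePerimeter α T,
      ∀ z ∉ B, (charGraph α T).Reachable z c := by
  obtain ⟨M, hM⟩ := ((finite_sitePerimeter (α := α) hT).image fun z => max |z.1| |z.2|).bddAbove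
  have hP (z : Pixel) (hz : M < |z.1| ∨ M < |z.2|) : z ∉ sitePerimeter α T := by
    intro hzP
    have hle : |z.1| ≤ M ∧ |z.2| ≤ M := max_le_iff.1 (hM ⟨z, hzP, rfl⟩)
    omega
  have hcolumn {x : ℤ} (hx : M < |x|) (y y' : ℤ) : (charGraph α T).Reachable (x, y) (x, y') :=
    reachable_of_adj_add_one (r := fun y => (x, y)) (fun _ => charGraph_adj_of_adj_four
      (hP _ (.inl hx)) (hP _ (.inl hx)) (by simp [adj_four_iff])) y y'
  have hrow {y : ℤ} (hy : M < |y|) (x x' : ℤ) : (charGraph α T).Reachable (x, y) (x', y) :=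
    reachable_of_adj_add_one (r := fun x => (x, y)) (fun _ => charGraph_adj_of_adj_four
      (hP _ (.inr hy)) (hP _ (.inr hy)) (by simp [adj_four_iff])) x x'
  have hcorner : M < |M + 1| := (lt_add_one M).trans_le (le_abs_self _)
  refine ⟨Set.Icc (-M, -M) (M, M), Set.finite_Icc _ _, (M + 1, M + 1), hP _ (.inl hcorner), ?_⟩
  rintro ⟨x, y⟩ hxy
  have houtside : M < |x| ∨ M < |y| := by
    by_contra! hle
    exact hxy (by simpa [abs_le, and_and_and_comm] using hle)
  rcases houtside with hx | hy
  · exact (hcolumn hx _ _).trans (hrow hcorner _ _)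
  · exact (hrow hy _ _).trans (hcolumn hcorner _ _)

theorem existsUnique_infinite_connectedComponent (hT : T.Finite) :
    ∃ C : (charGraph α T).ConnectedComponent, C.supp = exteriorRegion α T ∧ C.supp.Infinite ∧
      ∀ C' : (charGraph α T).ConnectedComponent, C'.supp.Infinite → C' = C := by
  obtain ⟨B, hB, c, hcP, hc⟩ := exists_finite_forall_notMem_reachable (α := α) hT
  have hinf := infinite_supp_iff_eq_connectedComponentMk hB hc
  refine ⟨_, Set.ext fun z => ?_, (hinf _).2 rfl, fun C' => (hinf C').1⟩
  rw [mem_exteriorRegion, hinf, ConnectedComponent.mem_supp_iff, iff_and_self]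
  exact fun hz => mt (mem_sitePerimeter_iff_of_reachable (ConnectedComponent.exact hz)).1 hcP

theorem mem_of_adj_of_notMem_sitePerimeter (ht : t ∈ T) (htz : (adjGraph α).Adj t z)
    (hz : z ∉ sitePerimeter α T) : z ∈ T := by
  by_contra hzT
  exact hz ⟨hzT, t, ht, htz.symm⟩

theorem disjoint_exteriorRegion (hT : T.Finite) : Disjoint T (exteriorRegion α T) := by
  refine Set.disjoint_left.2 fun t ht htE => (mem_exteriorRegion.1 htE).2 (hT.subset fun z hz => ?_)
  refine mem_of_reachable (fun x hx y hxy => ?_) (ConnectedComponent.exact hz).symm ht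
  rcases charGraph_adj.1 hxy with ⟨-, hyP, hadj⟩ | ⟨hxP, -⟩
  · exact mem_of_adj_of_notMem_sitePerimeter hx hadj hyP
  · exact (hxP.1 hx).elim

theorem mem_exteriorRegion_of_adj (hx : x ∈ exteriorRegion α T) (hxy : (adjGraph α).Adj x y)
    (hy : y ∉ sitePerimeter α T) : y ∈ exteriorRegion α T := by
  rw [mem_exteriorRegion] at *
  have hadj : (charGraph α T).Adj x y := charGraph_adj.2 (.inl ⟨hx.1, hy, hxy⟩)
  exact ⟨hy, ConnectedComponent.sound hadj.reachable ▸ hx.2⟩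

theorem connected_induce_exteriorRegion (hT : T.Finite) :
    ((adjGraph α).induce (exteriorRegion α T)).Connected := by
  obtain ⟨C, hC, -⟩ := existsUnique_infinite_connectedComponent (α := α) hT
  have hconn : ((charGraph α T).induce (exteriorRegion α T)).Connected :=
    hC ▸ C.connected_toSimpleGraph
  refine hconn.mono fun x y hxy => ?_
  rcases charGraph_adj.1 hxy with ⟨-, -, hadj⟩ | ⟨hxP, -⟩
  · exact hadj
  · exact ((mem_exteriorRegion.1 x.2).1 hxP).elim

theorem isInterface_extSitePerimeter (hconn : ((adjGraph α).induce T).Connected)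
    (hT : T.Finite) : IsInterface α T (exteriorRegion α T) (extSitePerimeter α T) where
  connected_left := hconn
  connected_right := connected_induce_exteriorRegion hT
  disjoint := disjoint_exteriorRegion hT
  disjoint_left := Set.disjoint_left.2 fun _ hz => hz.1.1
  disjoint_right := Set.disjoint_left.2 fun _ hz he => (mem_exteriorRegion.1 he).1 hz.1
  not_adj _ ht _ he hte := (disjoint_exteriorRegion hT).notMem_of_mem_left
    (mem_of_adj_of_notMem_sitePerimeter ht hte (mem_exteriorRegion.1 he).1) he
  exists_left _ hs := hs.1.2
  exists_right _ hs := hs.2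
  mem_or_mem e he _ hez := or_iff_not_imp_right.2 fun hz =>
    mem_exteriorRegion_of_adj he hez fun hzP => hz ⟨hzP, e, he, hez.symm⟩

end Perimeter

section Length

variable {α : Conn} {T : Set Pixel} {t x y z d : Pixel}

/-- The coordinate of `z` along `d`; it is meant for the four axis directions `d`. -/
def height (d z : Pixel) : ℤ :=
  d.1 * z.1 + d.2 * z.2

theorem eq_of_adj_four_zero (hd : (adjGraph .four).Adj 0 d) :
    d = (1, 0) ∨ d = (-1, 0) ∨ d = (0, 1) ∨ d = (0, -1) := by
  simp only [adj_four_iff, Prod.ext_iff, Prod.fst_zero, Prod.snd_zero] at *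
  omega

theorem height_le_height_add_one (hd : (adjGraph .four).Adj 0 d)
    (hxy : (adjGraph α).Adj x y) : height d x ≤ height d y + 1 := by
  have hbounds := adj_eight_iff.1 (adjGraph_le_eight α hxy)
  rcases eq_of_adj_four_zero hd with rfl | rfl | rfl | rfl <;> simp only [height] <;> omega

theorem height_add_nsmul (hd : (adjGraph .four).Adj 0 d) (z : Pixel) (k : ℕ) :
    height d (z + k • d) = height d z + k := by
  rcases eq_of_adj_four_zero hd with rfl | rfl | rfl | rfl <;>
    simp only [height, Prod.fst_add, Prod.snd_add, Prod.smul_fst, Prod.smul_snd,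
      Int.nsmul_eq_mul] <;>
    ring

theorem mem_exteriorRegion_of_forall_nsmul_notMem (hd : (adjGraph .four).Adj 0 d)
    (hray : ∀ k : ℕ, z + k • d ∉ sitePerimeter α T) : z ∈ exteriorRegion α T := by
  have hstep (k : ℕ) : (charGraph α T).Adj (z + k • d) (z + (k + 1) • d) := by
    refine charGraph_adj_of_adj_four (hray k) (hray (k + 1)) ?_
    rwa [succ_nsmul, ← add_assoc, adj_self_add]
  have hreach (k : ℕ) : (charGraph α T).Reachable (z + k • d) z := by
    simpa using reachable_of_adj_add_one (r := fun k : ℕ => z + k • d) hstep k 0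
  have hinj : Function.Injective fun k : ℕ => z + k • d := fun k l hkl => by
    have hheight := congrArg (height d) hkl
    simp only [height_add_nsmul hd] at hheight
    omega
  exact mem_exteriorRegion.2 ⟨by simpa using hray 0,
    Set.infinite_of_injective_forall_mem hinj fun k => ConnectedComponent.sound (hreach k)⟩

theorem mem_extSitePerimeter_of_height_eq (hd : (adjGraph .four).Adj 0 d) (ht : t ∈ T)
    (hmax : ∀ t' ∈ T, height d t' ≤ height d t) (hzt : (adjGraph α).Adj z t)
    (hz : height d z = height d t + 1) : z ∈ extSitePerimeter α T := by
  have hP : ∀ p ∈ sitePerimeter α T, height d p ≤ height d z := by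
    rintro p ⟨-, t', ht', hpt'⟩
    linarith [hmax t' ht', height_le_height_add_one hd hpt']
  have hzd : z + d ∈ exteriorRegion α T := by
    refine mem_exteriorRegion_of_forall_nsmul_notMem hd fun k hk => ?_
    rw [add_assoc, ← succ_nsmul'] at hk
    have hle := hP _ hk
    rw [height_add_nsmul hd] at hle
    omega
  have hzT : z ∉ T := fun hzT => by linarith [hmax z hzT]
  exact ⟨⟨hzT, t, ht, hzt⟩, z + d, hzd, adjGraph_four_le α ((adj_self_add _ z d).2 hd)⟩

theorem exists_forall_mem_extSitePerimeter (hne : T.Nonempty) (hT : T.Finite)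
    (hd : (adjGraph .four).Adj 0 d) :
    ∃ t ∈ T, (∀ t' ∈ T, height d t' ≤ height d t) ∧
      ∀ z, (adjGraph α).Adj z t → height d z = height d t + 1 → z ∈ extSitePerimeter α T := by
  obtain ⟨t, ht, hmax⟩ := Set.exists_max_image T (height d) hT hne
  exact ⟨t, ht, hmax, fun z => mem_extSitePerimeter_of_height_eq hd ht hmax⟩

theorem finite_extSitePerimeter (hT : T.Finite) : (extSitePerimeter α T).Finite :=
  (finite_sitePerimeter hT).subset fun _ hz => hz.1

theorem length_le_ncard_of_nodup {V : Type*} {l : List V} (hl : l.Nodup) {S : Set V}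
    (hS : S.Finite) (hlS : ∀ x ∈ l, x ∈ S) : l.length ≤ S.ncard := by
  classical
  rw [← List.toFinset_card_of_nodup hl, ← Set.ncard_coe_finset]
  exact Set.ncard_le_ncard (fun x hx => hlS x (by simpa using hx)) hS

theorem minCycleLength_le_ncard_extSitePerimeter (hne : T.Nonempty) (hT : T.Finite) :
    α.dual.minCycleLength ≤ (extSitePerimeter α T).ncard := by
  have hextreme {d : Pixel} := exists_forall_mem_extSitePerimeter (α := α) (d := d) hne hT
  obtain ⟨⟨r₁, r₂⟩, hr, hrmax, hright⟩ := hextreme (d := (1, 0)) (by simp [adj_four_iff])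
  obtain ⟨⟨l₁, l₂⟩, hl, -, hleft⟩ := hextreme (d := (-1, 0)) (by simp [adj_four_iff])
  obtain ⟨⟨u₁, u₂⟩, -, humax, hup⟩ := hextreme (d := (0, 1)) (by simp [adj_four_iff])
  obtain ⟨⟨d₁, d₂⟩, hd, hdmax, hdown⟩ := hextreme (d := (0, -1)) (by simp [adj_four_iff])
  have hlr := hrmax _ hl
  have hru := humax _ hr
  have hlu := humax _ hl
  have hdu := humax _ hd
  have hrd := hdmax _ hr
  have hld := hdmax _ hl
  simp only [height] at hlr hru hlu hdu hrd hld hright hleft hup hdown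
  cases α with
  | four =>
    refine length_le_ncard_of_nodup (l := [(r₁ + 1, r₂), (l₁ - 1, l₂), (u₁, u₂ + 1), (d₁, d₂ - 1)])
      ?_ (finite_extSitePerimeter hT) ?_
    · simp only [List.nodup_cons, List.mem_cons, Prod.mk.injEq, List.not_mem_nil, List.nodup_nil,
        or_false, not_false_eq_true, and_true]
      omega
    · simp only [List.forall_mem_cons, adj_four_iff] at *
      refine ⟨hright _ ?_ ?_, hleft _ ?_ ?_, hup _ ?_ ?_, hdown _ ?_ ?_, by simp⟩ <;>
        dsimp only <;> omega
  | eight =>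
    refine length_le_ncard_of_nodup
      (l := [(r₁ + 1, r₂), (l₁ - 1, l₂), (u₁, u₂ + 1), (u₁ - 1, u₂ + 1), (u₁ + 1, u₂ + 1),
        (d₁, d₂ - 1), (d₁ - 1, d₂ - 1), (d₁ + 1, d₂ - 1)]) ?_ (finite_extSitePerimeter hT) ?_
    · simp only [List.nodup_cons, List.mem_cons, Prod.mk.injEq, List.not_mem_nil, List.nodup_nil,
        or_false, not_false_eq_true, and_true]
      omega
    · simp only [List.forall_mem_cons, adj_eight_iff, ne_eq, Prod.mk.injEq, Prod.forall] at *
      refine ⟨hright _ _ ?_ ?_, hleft _ _ ?_ ?_, hup _ _ ?_ ?_, hup _ _ ?_ ?_, hup _ _ ?_ ?_,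
        hdown _ _ ?_ ?_, hdown _ _ ?_ ?_, hdown _ _ ?_ ?_, by simp⟩ <;> omega

theorem isSimpleCycle_extSitePerimeter (hconn : ((adjGraph α).induce T).Connected)
    (hT : T.Finite) : IsSimpleCycle α.dual (extSitePerimeter α T) :=
  (isInterface_extSitePerimeter hconn hT).isSimpleCycle (finite_extSitePerimeter hT)
    (minCycleLength_le_ncard_extSitePerimeter (Set.nonempty_coe_sort.1 hconn.nonempty) hT)

end Length

theorem lemma5p1 (α : Conn) (I : BinaryImage) (T : Set Pixel)
    (hT : IsConnComponent α I T) (hfin : T.Finite) :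
    (∃ C : (charGraph α T).ConnectedComponent,
      C.supp = exteriorRegion α T ∧ C.supp.Infinite ∧
        ∀ C' : (charGraph α T).ConnectedComponent, C'.supp.Infinite → C' = C) ∧
    IsSimpleCycle α.dual (extSitePerimeter α T) :=
  ⟨existsUnique_infinite_connectedComponent hfin,
    isSimpleCycle_extSitePerimeter hT.connected_induce hfin⟩
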